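/- Let $n\ge 1$ be a natural number and let $\sum_{m=1}^\infty a_m$ be a conditionally convergent series of real numbers (i.e. convergent, but not absolutely convergent). Let $\mathrm{Sym}(n)$ be the group of all permutations of $\{1,\dots,n\}$, and for each $\sigma\in\mathrm{Sym}(n)$ let $s^{(\sigma)}\in\mathbb R\cup\{+\infty,-\infty\}$ be given. Then there is a rearrangement $b:\mathbb N^n\to\mathbb R$ of $(a_m)_m$, i.e. a function of the form $b(j_1,\dots,j_n)=a_{\tau(j_1,\dots,j_n)}$ with a bijection $\tau:\mathbb N^n\to\mathbb N$, such that for every $\sigma\in\mathrm{Sym}(n)$ $$\sum_{j_1=1}^\infty\sum_{j_2=1}^\infty\cdots\sum_{j_n=1}^\infty b(j_{\sigma(1)},\dots,j_{\sigma(n)})=s^{(\sigma)}.$$ Here the sum over $j_1$ is the outermost one, each series is the limit of its partial sums in the natural order, all the inner iterated series (those over $j_l,\dots,j_n$ with $l\ge2$, for all fixed $j_1,\dots,j_{l-1}$) converge to real numbers, and only the outermost series may diverge to $\pm\infty$. -/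

import Mathlib

open Filter Topology

/-- The series `∑ u k` of real numbers, summed in its natural order, has the value `s`
in `ℝ ∪ {±∞}`: its partial sums converge to `s` in the extended real line. -/
def SeriesHasSum (u : ℕ → ℝ) (s : EReal) : Prop :=
  Tendsto (fun N : ℕ => ((∑ k ∈ Finset.range N, u k : ℝ) : EReal)) atTop (𝓝 s)

/-- The series `∑ a m` of real numbers converges (to a real number), but not absolutely. -/
def ConditionallyConvergent (a : ℕ → ℝ) : Prop :=
  (∃ t : ℝ, SeriesHasSum a (t : EReal)) ∧ ¬ Summable (fun m => |a m|)

/-- `b`, a family indexed by `ℕⁿ`, is a rearrangement of the sequence `a`. -/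
def IsRearrangement {n : ℕ} (a : ℕ → ℝ) (b : (Fin n → ℕ) → ℝ) : Prop :=
  ∃ τ : (Fin n → ℕ) → ℕ, Function.Bijective τ ∧ ∀ j, b j = a (τ j)

/-- The iterated series `∑_{j₁} ∑_{j₂} ⋯ ∑_{jₙ} f (j₁, …, jₙ)` (first index outermost) is
well defined and has the value `s`: for each value `k` of the first index the inner iterated
series converges to a real number `u k`, and the series `∑ u k` has the value `s` in
`ℝ ∪ {±∞}`. For `n = 0` the value is the single entry of `f`. -/
def HasIteratedSum : (n : ℕ) → ((Fin n → ℕ) → ℝ) → EReal → Prop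
  | 0, f, s => s = (f Fin.elim0 : EReal)
  | n + 1, f, s => ∃ u : ℕ → ℝ,
      (∀ k : ℕ, HasIteratedSum n
        (fun j : Fin n → ℕ => f (Fin.cons k j : Fin (n + 1) → ℕ)) (u k : EReal)) ∧
      SeriesHasSum u s

/-! The core is a stronger statement: the terms can be placed on `ℕⁿ⁺¹` so that every line parallel
to an axis has a prescribed sum (`exists_rearrangement_line_sums`). Each cell is assigned to the
line through it in the direction of its largest coordinate, ties being broken. A line then owns all
but finitely many of its cells, and the others belong to lines of smaller rank. The series splits
into countably many subseries, one per line, each with divergent positive and negative parts. By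
recursion on the rank, Riemann's theorem arranges each subseries on the owned cells so as to make up
what the foreign cells leave missing.

The theorem follows by induction on the dimension. For each coordinate `i`, the induction hypothesis
gives a real array `L i` whose iterated sums are the values prescribed for the orders with `i`
innermost; the line sums in direction `i` are then required to be `L i`. -/

lemma SeriesHasSum.congr {u v : ℕ → ℝ} {s : EReal} (h : SeriesHasSum u s) (e : ∀ k, u k = v k) :
    SeriesHasSum v s := by
  obtain rfl : u = v := funext e
  exact h

lemma tendsto_coe_add_of_tendsto_zero {x y : ℕ → ℝ} {s : EReal}
    (hx : Tendsto (fun k => (x k : EReal)) atTop (𝓝 s)) (hy : Tendsto y atTop (𝓝 0)) :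
    Tendsto (fun k => ((x k + y k : ℝ) : EReal)) atTop (𝓝 s) := by
  have hy' : Tendsto (fun k => (y k : EReal)) atTop (𝓝 ((0 : ℝ) : EReal)) :=
    (continuous_coe_real_ereal.tendsto 0).comp hy
  have h := (EReal.continuousAt_add (p := (s, ((0 : ℝ) : EReal)))
    (Or.inr (EReal.coe_ne_bot 0)) (Or.inr (EReal.coe_ne_top 0))).tendsto.comp
      (hx.prodMk_nhds hy')
  simpa [Function.comp_def] using h

/-- Prepending finitely many terms with total `C` to a series with sum `s - C` gives a series
with sum `s`. -/
lemma seriesHasSum_of_tail {u : ℕ → ℝ} {s : EReal} (K : ℕ)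
    (h : SeriesHasSum (fun m => u (K + m)) (s - ((∑ k ∈ Finset.range K, u k : ℝ) : EReal))) :
    SeriesHasSum u s := by
  set C : ℝ := ∑ k ∈ Finset.range K, u k with hC
  have h1 : Tendsto (fun N : ℕ => ((∑ k ∈ Finset.range N, u (K + k) : ℝ) : EReal) + (C : EReal))
      atTop (𝓝 (s - C + C)) :=
    (EReal.continuousAt_add (p := (s - (C : EReal), (C : EReal)))
      (Or.inr (EReal.coe_ne_bot C)) (Or.inr (EReal.coe_ne_top C))).tendsto.comp
        (h.prodMk_nhds tendsto_const_nhds)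
  have h2 : s - (C : EReal) + C = s := by
    induction s with
    | bot => simp
    | top => simp
    | coe r => norm_cast; ring
  rw [h2] at h1
  unfold SeriesHasSum
  rw [← tendsto_add_atTop_iff_nat K]
  refine h1.congr fun N => ?_
  rw [add_comm N K, Finset.sum_range_add, ← hC, ← EReal.coe_add, add_comm]

/-! ### Riemann's rearrangement theorem -/

section Merge

variable (r : ℕ → ℕ → Prop) [∀ p q, Decidable (r p q)]

/-- The lattice path starting at the origin which at `(p, q)` moves in the first direction
if `r p q` holds and in the second direction otherwise. -/
def mergePath : ℕ → ℕ × ℕ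
  | 0 => (0, 0)
  | k + 1 => if r (mergePath k).1 (mergePath k).2 then ((mergePath k).1 + 1, (mergePath k).2)
      else ((mergePath k).1, (mergePath k).2 + 1)

/-- The step taken by `mergePath r` at time `k`, as an element of the disjoint union of two
copies of `ℕ`. -/
def mergeItem (k : ℕ) : ℕ ⊕ ℕ :=
  if r (mergePath r k).1 (mergePath r k).2 then Sum.inl (mergePath r k).1
  else Sum.inr (mergePath r k).2

lemma mergePath_fst_mono : Monotone fun k => (mergePath r k).1 :=
  monotone_nat_of_le_succ fun k => by
    simp only [mergePath]; split_ifs <;> simp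

lemma mergePath_snd_mono : Monotone fun k => (mergePath r k).2 :=
  monotone_nat_of_le_succ fun k => by
    simp only [mergePath]; split_ifs <;> simp

lemma mergePath_fst_add_snd (k : ℕ) : (mergePath r k).1 + (mergePath r k).2 = k := by
  induction k with
  | zero => rfl
  | succ k ih => simp only [mergePath]; split_ifs <;> simp <;> omega

lemma mergeItem_injective : Function.Injective (mergeItem r) := by
  have key : ∀ k l, k < l → mergeItem r k ≠ mergeItem r l := by
    intro k l hkl
    have h1 := mergePath_fst_mono r (Nat.succ_le_of_lt hkl)
    have h2 := mergePath_snd_mono r (Nat.succ_le_of_lt hkl)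
    simp only [mergePath] at h1 h2
    unfold mergeItem
    split_ifs with ha hb hb
    · simp only [ha, if_true] at h1
      simp only [ne_eq, Sum.inl.injEq]; omega
    · simp
    · simp
    · simp only [ha, if_false] at h2
      simp only [ne_eq, Sum.inr.injEq]; omega
  intro k l h
  rcases lt_trichotomy k l with hkl | hkl | hkl
  · exact absurd h (key _ _ hkl)
  · exact hkl
  · exact absurd h.symm (key _ _ hkl)

/-- A coordinate grows by unit steps, so the step that first lifts it above `m` is the one that
starts at `m`. -/
lemma mergeItem_surjective (h1 : Tendsto (fun k => (mergePath r k).1) atTop atTop)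
    (h2 : Tendsto (fun k => (mergePath r k).2) atTop atTop) :
    Function.Surjective (mergeItem r) := by
  classical
  rintro (m | m)
  · have hex : ∃ k, m < (mergePath r k).1 := (h1.eventually_gt_atTop m).exists
    obtain ⟨k, hk⟩ : ∃ k, Nat.find hex = k + 1 := by
      refine Nat.exists_eq_succ_of_ne_zero fun h0 => ?_
      have := Nat.find_spec hex
      simp [h0, mergePath] at this
    have hs := Nat.find_spec hex
    have hm := Nat.find_min hex (m := k) (by omega)
    rw [hk] at hs
    simp only [mergePath] at hs
    refine ⟨k, ?_⟩
    unfold mergeItem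
    split_ifs at hs ⊢ with ha
    · congr 1; simp at hs; omega
    · exact absurd hs hm
  · have hex : ∃ k, m < (mergePath r k).2 := (h2.eventually_gt_atTop m).exists
    obtain ⟨k, hk⟩ : ∃ k, Nat.find hex = k + 1 := by
      refine Nat.exists_eq_succ_of_ne_zero fun h0 => ?_
      have := Nat.find_spec hex
      simp [h0, mergePath] at this
    have hs := Nat.find_spec hex
    have hm := Nat.find_min hex (m := k) (by omega)
    rw [hk] at hs
    simp only [mergePath] at hs
    refine ⟨k, ?_⟩
    unfold mergeItem
    split_ifs at hs ⊢ with ha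
    · exact absurd hs hm
    · congr 1; simp at hs; omega

end Merge

/-- Merging two divergent series of nonnegative terms, the first with plus signs and the second
with minus signs, so that the result has a prescribed sum in the extended reals. -/
lemma exists_merge_hasSum {f g : ℕ → ℝ} (hf : ∀ k, 0 ≤ f k) (hg : ∀ k, 0 ≤ g k)
    (hf0 : Tendsto f atTop (𝓝 0)) (hg0 : Tendsto g atTop (𝓝 0))
    (hfs : ¬ Summable f) (hgs : ¬ Summable g) (s : EReal) :
    ∃ e : ℕ ≃ ℕ ⊕ ℕ, SeriesHasSum (fun k => Sum.elim f (fun q => -g q) (e k)) s := by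
  classical
  set A : ℕ → ℝ := fun p => ∑ i ∈ Finset.range p, f i with hA
  set B : ℕ → ℝ := fun p => ∑ i ∈ Finset.range p, g i with hB
  have hAt : Tendsto A atTop atTop := (not_summable_iff_tendsto_nat_atTop_of_nonneg hf).1 hfs
  have hBt : Tendsto B atTop atTop := (not_summable_iff_tendsto_nat_atTop_of_nonneg hg).1 hgs
  have hAm : Monotone A := monotone_nat_of_le_succ fun p => by
    simp only [hA, Finset.sum_range_succ]; linarith [hf p]
  have hBm : Monotone B := monotone_nat_of_le_succ fun p => by
    simp only [hB, Finset.sum_range_succ]; linarith [hg p]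
  -- `T q` is the level the positive part should follow once `q` negative terms are used. Having `T`
  -- itself tend to infinity, even for `s = ⊥`, forces both kinds of terms to be used up.
  obtain ⟨T, hTm, hTt, hTs⟩ : ∃ T : ℕ → ℝ, Monotone T ∧ Tendsto T atTop atTop ∧
      Tendsto (fun q => ((T q - B q : ℝ) : EReal)) atTop (𝓝 s) := by
    induction s with
    | bot =>
      refine ⟨fun q => B q / 2, fun x y h => ?_, hBt.atTop_div_const two_pos, ?_⟩
      · have := hBm h
        simp only; linarith
      · rw [EReal.tendsto_coe_nhds_bot_iff]
        have := tendsto_neg_atTop_atBot.comp (hBt.atTop_div_const (two_pos))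
        refine this.congr fun q => ?_
        simp only [Function.comp_apply]; ring
    | coe r =>
      refine ⟨fun q => B q + r, fun x y h => ?_, tendsto_atTop_add_const_right _ _ hBt, ?_⟩
      · have := hBm h
        simp only; linarith
      · simp
    | top =>
      refine ⟨fun q => B q * 2, fun x y h => ?_, hBt.atTop_mul_const two_pos, ?_⟩
      · have := hBm h
        simp only; linarith
      · rw [EReal.tendsto_coe_nhds_top_iff]
        refine hBt.congr fun q => ?_
        ring
  set r : ℕ → ℕ → Prop := fun p q => A p ≤ T q with hr
  set P : ℕ → ℕ := fun k => (mergePath r k).1 with hP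
  set Q : ℕ → ℕ := fun k => (mergePath r k).2 with hQ
  have hPm : Monotone P := mergePath_fst_mono r
  have hQm : Monotone Q := mergePath_snd_mono r
  have hPQ : ∀ k, P k + Q k = k := mergePath_fst_add_snd r
  have hP1 : ∀ k, A (P k) ≤ T (Q k) → P (k + 1) = P k + 1 ∧ Q (k + 1) = Q k := fun k h => by
    have : r (mergePath r k).1 (mergePath r k).2 := h
    simp [hP, hQ, mergePath, this]
  have hQ1 : ∀ k, ¬ A (P k) ≤ T (Q k) → P (k + 1) = P k ∧ Q (k + 1) = Q k + 1 := fun k h => by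
    have : ¬ r (mergePath r k).1 (mergePath r k).2 := h
    simp [hP, hQ, mergePath, this]
  -- If `P` stayed below `b`, then `Q` and hence `T (Q k)` would grow past `A b`, after which every
  -- step would increase `P`. The argument for `Q` is symmetric.
  have hPt : Tendsto P atTop atTop := by
    refine tendsto_atTop_atTop_of_monotone hPm ?_
    by_contra! hb
    obtain ⟨b, hb⟩ := hb
    have hQt : Tendsto Q atTop atTop := by
      refine tendsto_atTop_mono (f := fun k => k - b) (fun k => ?_) (tendsto_sub_atTop_nat b)
      have := hPQ k
      have := hb k
      omega
    obtain ⟨M, hM⟩ := (eventually_atTop.1 ((hTt.comp hQt).eventually_ge_atTop (A b)))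
    have hstep : ∀ j, P (M + j) = P M + j := by
      intro j
      induction j with
      | zero => rfl
      | succ j ih =>
        have := (hP1 (M + j) ((hAm (hb _).le).trans (hM _ (by omega)))).1
        rw [← add_assoc, this, ih]; ring
    have h1 := hstep b
    have h2 := hb (M + b)
    omega
  have hQt : Tendsto Q atTop atTop := by
    refine tendsto_atTop_atTop_of_monotone hQm ?_
    by_contra! hb
    obtain ⟨b, hb⟩ := hb
    obtain ⟨M, hM⟩ := (eventually_atTop.1 ((hAt.comp hPt).eventually_gt_atTop (T b)))
    have hstep : ∀ j, Q (M + j) = Q M + j := by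
      intro j
      induction j with
      | zero => rfl
      | succ j ih =>
        have := (hQ1 (M + j) (not_le.2 ((hTm (hb _).le).trans_lt (hM _ (by omega))))).2
        rw [← add_assoc, this, ih]; ring
    have h1 := hstep b
    have h2 := hb (M + b)
    omega
  have hbij : Function.Bijective (mergeItem r) :=
    ⟨mergeItem_injective r, mergeItem_surjective r hPt hQt⟩
  refine ⟨Equiv.ofBijective (mergeItem r) hbij, ?_⟩
  have hsum : ∀ N, ∑ k ∈ Finset.range N, Sum.elim f (fun q => -g q) (mergeItem r k)
      = A (P N) - B (Q N) := by
    intro N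
    induction N with
    | zero => simp [hA, hB, hP, hQ, mergePath]
    | succ N ih =>
      rw [Finset.sum_range_succ, ih]
      by_cases h : A (P N) ≤ T (Q N)
      · have h' : r (mergePath r N).1 (mergePath r N).2 := h
        rw [(hP1 N h).1, (hP1 N h).2]
        simp only [mergeItem, h', if_true, Sum.elim_inl, hA, Finset.sum_range_succ]
        ring
      · have h' : ¬ r (mergePath r N).1 (mergePath r N).2 := h
        rw [(hQ1 N h).1, (hQ1 N h).2]
        simp only [mergeItem, h', if_false, Sum.elim_inr, hB, Finset.sum_range_succ]
        ring
  -- The inequality held when the last positive term was taken, and `T` has only grown since. Thus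
  -- the overshoot is at most one term, which tends to zero; `hlow` is the mirror image.
  have hup : ∀ k, 0 < P k → A (P k - 1) ≤ T (Q k) := by
    intro k
    induction k with
    | zero => intro h; simp [hP, mergePath] at h
    | succ k ih =>
      intro h
      by_cases hc : A (P k) ≤ T (Q k)
      · rw [(hP1 k hc).1, (hP1 k hc).2]; simpa using hc
      · rw [(hQ1 k hc).1] at h ⊢
        exact (ih h).trans (hTm (by rw [(hQ1 k hc).2]; omega))
  have hlow : ∀ k, 0 < Q k → T (Q k - 1) < A (P k) := by
    intro k
    induction k with
    | zero => intro h; simp [hQ, mergePath] at h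
    | succ k ih =>
      intro h
      by_cases hc : A (P k) ≤ T (Q k)
      · rw [(hP1 k hc).2] at h ⊢
        exact (ih h).trans_le (hAm (by rw [(hP1 k hc).1]; omega))
      · rw [(hQ1 k hc).1, (hQ1 k hc).2]; simpa using hc
  have hP' : Tendsto (fun k => P k - 1) atTop atTop := (tendsto_sub_atTop_nat 1).comp hPt
  have hQ' : Tendsto (fun k => Q k - 1) atTop atTop := (tendsto_sub_atTop_nat 1).comp hQt
  have hU := tendsto_coe_add_of_tendsto_zero (hTs.comp hQt) (hf0.comp hP')
  have hL := tendsto_coe_add_of_tendsto_zero (hTs.comp hQ')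
    (by simpa using (hg0.comp hQ').neg : Tendsto (fun k => -g (Q k - 1)) atTop (𝓝 0))
  unfold SeriesHasSum
  simp only [Equiv.ofBijective_apply, hsum]
  refine tendsto_of_tendsto_of_tendsto_of_le_of_le' hL hU ?_ ?_
  · filter_upwards [hQt.eventually_gt_atTop 0] with k hk
    rw [EReal.coe_le_coe_iff]
    have h1 := hlow k hk
    have h2 : B (Q k) = B (Q k - 1) + g (Q k - 1) := by
      conv_lhs => rw [← Nat.sub_add_cancel hk]
      simp only [hB, Finset.sum_range_succ]
    rw [h2]
    linarith
  · filter_upwards [hPt.eventually_gt_atTop 0] with k hk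
    rw [EReal.coe_le_coe_iff]
    have h1 := hup k hk
    have h2 : A (P k) = A (P k - 1) + f (P k - 1) := by
      conv_lhs => rw [← Nat.sub_add_cancel hk]
      simp only [hA, Finset.sum_range_succ]
    simp only [Function.comp_apply]
    rw [h2]
    linarith

/-- **Riemann's rearrangement theorem** for families on a countable index type. -/
theorem exists_equiv_seriesHasSum {ι : Type*} [Countable ι] {a : ι → ℝ}
    (h0 : Tendsto a cofinite (𝓝 0)) (hp : ¬ Summable fun i => max (a i) 0)
    (hn : ¬ Summable fun i => max (-a i) 0) (s : EReal) :
    ∃ e : ℕ ≃ ι, SeriesHasSum (fun k => a (e k)) s := by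
  classical
  have hp' : ¬ Summable fun i : {i // 0 ≤ a i} => a i := by
    intro h
    refine hp ?_
    have := summable_subtype_iff_indicator (f := a) (s := {i | 0 ≤ a i}) |>.1 h
    refine this.congr fun i => ?_
    by_cases hi : 0 ≤ a i
    · simp [hi]
    · simp [hi, (not_le.1 hi).le]
  have hn' : ¬ Summable fun i : {i // ¬ 0 ≤ a i} => -a i := by
    intro h
    refine hn ?_
    have := summable_subtype_iff_indicator (f := fun i => -a i) (s := {i | ¬ 0 ≤ a i}) |>.1 h
    refine this.congr fun i => ?_
    by_cases hi : 0 ≤ a i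
    · simp [hi]
    · simp [hi, (not_le.1 hi).le]
  have : Infinite {i // 0 ≤ a i} :=
    not_finite_iff_infinite.1 fun _ => hp' (summable_of_hasFiniteSupport (Set.toFinite _))
  have : Infinite {i // ¬ 0 ≤ a i} :=
    not_finite_iff_infinite.1 fun _ => hn' (summable_of_hasFiniteSupport (Set.toFinite _))
  obtain ⟨e1⟩ := nonempty_equiv_of_countable (α := ℕ) (β := {i // 0 ≤ a i})
  obtain ⟨e2⟩ := nonempty_equiv_of_countable (α := ℕ) (β := {i // ¬ 0 ≤ a i})
  have t1 : Tendsto (fun k => a (e1 k)) atTop (𝓝 0) := by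
    rw [← Nat.cofinite_eq_atTop]
    exact h0.comp (Subtype.val_injective.comp e1.injective).tendsto_cofinite
  have t2 : Tendsto (fun k => -a (e2 k)) atTop (𝓝 0) := by
    rw [← Nat.cofinite_eq_atTop]
    simpa using (h0.comp (Subtype.val_injective.comp e2.injective).tendsto_cofinite).neg
  obtain ⟨e, he⟩ := exists_merge_hasSum (fun k => (e1 k).2)
    (fun k => neg_nonneg.2 (not_le.1 (e2 k).2).le) t1 t2
    (fun h => hp' ((Equiv.summable_iff e1).1 h)) (fun h => hn' ((Equiv.summable_iff e2).1 h)) s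
  refine ⟨e.trans ((Equiv.sumCongr e1 e2).trans (Equiv.sumCompl fun i => 0 ≤ a i)),
    he.congr fun k => ?_⟩
  rcases h : e k with p | q <;> simp [h]

/-! ### Splitting a conditionally convergent series -/

lemma ConditionallyConvergent.tendsto_sum {a : ℕ → ℝ} (ha : ConditionallyConvergent a) :
    ∃ t : ℝ, Tendsto (fun N => ∑ k ∈ Finset.range N, a k) atTop (𝓝 t) := by
  obtain ⟨⟨t, ht⟩, -⟩ := ha
  exact ⟨t, EReal.tendsto_coe.1 ht⟩

lemma ConditionallyConvergent.tendsto_zero {a : ℕ → ℝ} (ha : ConditionallyConvergent a) :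
    Tendsto a atTop (𝓝 0) := by
  obtain ⟨t, ht⟩ := ha.tendsto_sum
  have h := ((tendsto_add_atTop_iff_nat 1).2 ht).sub ht
  simpa [Finset.sum_range_succ] using h

lemma ConditionallyConvergent.neg {a : ℕ → ℝ} (ha : ConditionallyConvergent a) :
    ConditionallyConvergent fun m => -a m := by
  obtain ⟨t, ht⟩ := ha.tendsto_sum
  refine ⟨⟨-t, ?_⟩, by simpa using ha.2⟩
  refine EReal.tendsto_coe.2 ?_
  simpa using ht.neg

/-- If the positive parts were summable, so would be the negative parts `max (a m) 0 - a m`, whose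
partial sums converge, and hence `|a m|`. -/
lemma ConditionallyConvergent.not_summable_posPart {a : ℕ → ℝ} (ha : ConditionallyConvergent a) :
    ¬ Summable fun m => max (a m) 0 := by
  intro h
  obtain ⟨t, ht⟩ := ha.tendsto_sum
  have h1 := (h.hasSum.tendsto_sum_nat.sub ht).congr fun N => by
    rw [← Finset.sum_sub_distrib]
  have h2 : Summable fun m => max (a m) 0 - a m := by
    by_contra hns
    exact not_tendsto_nhds_of_tendsto_atTop
      ((not_summable_iff_tendsto_nat_atTop_of_nonneg
        (fun m => sub_nonneg.2 (le_max_left _ _))).1 hns) _ h1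
  refine ha.2 ((h.add h2).congr fun m => ?_)
  rcases le_total 0 (a m) with hm | hm
  · simp [hm, abs_of_nonneg]
  · simp [hm, abs_of_nonpos]

lemma ConditionallyConvergent.not_summable_negPart {a : ℕ → ℝ} (ha : ConditionallyConvergent a) :
    ¬ Summable fun m => max (-a m) 0 :=
  ha.neg.not_summable_posPart

/-- If consecutive blocks `[φ r, φ (r + 1))` have `f`-sum at least `1`, and infinitely many of them
lie in `S`, then `f` is not summable on `S`. -/
lemma not_summable_of_blocks {f : ℕ → ℝ} {φ : ℕ → ℕ} (hφ : StrictMono φ)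
    (S : Set ℕ)
    (hS : ∃ᶠ r in atTop, (∀ m, φ r ≤ m → m < φ (r + 1) → m ∈ S) ∧
      1 ≤ ∑ m ∈ Finset.Ico (φ r) (φ (r + 1)), f m) :
    ¬ Summable fun m : S => f m := by
  intro h
  have h' : Summable (S.indicator f) := summable_subtype_iff_indicator.1 h
  have ht := h'.hasSum.tendsto_sum_nat.comp hφ.tendsto_atTop
  have hd := ((tendsto_add_atTop_iff_nat 1).2 ht).sub ht
  rw [sub_self] at hd
  obtain ⟨r, ⟨hr1, hr2⟩, hr3⟩ := (hS.and_eventually (hd.eventually_lt_const one_pos)).exists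
  simp only [Function.comp_apply] at hr3
  rw [← Finset.sum_Ico_eq_sub _ (hφ (Nat.lt_succ_self r)).le] at hr3
  have : ∑ m ∈ Finset.Ico (φ r) (φ (r + 1)), S.indicator f m
      = ∑ m ∈ Finset.Ico (φ r) (φ (r + 1)), f m :=
    Finset.sum_congr rfl fun m hm => by
      rw [Finset.mem_Ico] at hm
      exact Set.indicator_of_mem (hr1 m hm.1 hm.2) f
  linarith

/-- Two divergent series of nonnegative terms can be split simultaneously into countably many
divergent subseries. -/
lemma exists_partition_not_summable {Λ : Type*} [Countable Λ] [Nonempty Λ] {f g : ℕ → ℝ}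
    (hf : ∀ m, 0 ≤ f m) (hg : ∀ m, 0 ≤ g m) (hfs : ¬ Summable f) (hgs : ¬ Summable g) :
    ∃ c : ℕ → Λ, ∀ l, (¬ Summable fun m : {m // c m = l} => f m) ∧
      ¬ Summable fun m : {m // c m = l} => g m := by
  have hft := (not_summable_iff_tendsto_nat_atTop_of_nonneg hf).1 hfs
  have hgt := (not_summable_iff_tendsto_nat_atTop_of_nonneg hg).1 hgs
  have hnext : ∀ M : ℕ, ∃ N, M < N ∧ 1 ≤ ∑ m ∈ Finset.Ico M N, f m ∧
      1 ≤ ∑ m ∈ Finset.Ico M N, g m := by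
    intro M
    obtain ⟨N, h1, h2, h3⟩ := ((eventually_gt_atTop M).and
      ((hft.eventually_ge_atTop (∑ m ∈ Finset.range M, f m + 1)).and
      (hgt.eventually_ge_atTop (∑ m ∈ Finset.range M, g m + 1)))).exists
    refine ⟨N, h1, ?_, ?_⟩
    · rw [Finset.sum_Ico_eq_sub _ h1.le]; linarith
    · rw [Finset.sum_Ico_eq_sub _ h1.le]; linarith
  choose next hlt hnf hng using hnext
  set φ : ℕ → ℕ := fun r => next^[r] 0 with hφdef
  have hφs : ∀ r, φ (r + 1) = next (φ r) := fun r => Function.iterate_succ_apply' _ _ _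
  have hφ : StrictMono φ := strictMono_nat_of_lt_succ fun r => by rw [hφs]; exact hlt _
  obtain ⟨v, hv⟩ := exists_surjective_nat Λ
  set blk : ℕ → ℕ := fun m => Nat.findGreatest (fun r => φ r ≤ m) m with hblk
  have hblk' : ∀ r m, φ r ≤ m → m < φ (r + 1) → blk m = r := by
    intro r m h1 h2
    refine Nat.findGreatest_eq_iff.2 ⟨(hφ.id_le r).trans h1, fun _ => h1, fun k hk _ hkm => ?_⟩
    have := hφ.monotone (Nat.succ_le_of_lt hk)
    simp only [Nat.succ_eq_add_one] at this
    omega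
  -- Labelling block `r` by the first component of `Nat.unpair r` makes every label recur infinitely
  -- often.
  have hfreq : ∀ l, ∃ᶠ r in atTop, v (Nat.unpair r).1 = l := by
    intro l
    obtain ⟨k, rfl⟩ := hv l
    rw [frequently_atTop]
    exact fun R => ⟨Nat.pair k R, Nat.right_le_pair k R, by simp⟩
  refine ⟨fun m => v (Nat.unpair (blk m)).1, fun l => ⟨?_, ?_⟩⟩
  · refine not_summable_of_blocks hφ {m | v (Nat.unpair (blk m)).1 = l}
      ((hfreq l).mono fun r hr => ⟨fun m h1 h2 => ?_, by rw [hφs]; exact hnf _⟩)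
    simp [hblk' r m h1 h2, hr]
  · refine not_summable_of_blocks hφ {m | v (Nat.unpair (blk m)).1 = l}
      ((hfreq l).mono fun r hr => ⟨fun m h1 h2 => ?_, by rw [hφs]; exact hng _⟩)
    simp [hblk' r m h1 h2, hr]

/-! ### Prescribing the sums along lines -/

/-- A countable system of lines in a set `X` of cells: every cell is owned by one line through it,
and every line owns precisely its cells from some position on. If the remaining cells of a line
are owned by lines of smaller rank, then the terms of a conditionally convergent series
can be distributed over the cells with a prescribed sum along every line. -/
theorem exists_bijective_line_sums {X Λ : Type*} [Countable Λ] [Nonempty Λ] {a : ℕ → ℝ}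
    (ha : ConditionallyConvergent a) (line : Λ → ℕ → X) (owner : X → Λ) (K : Λ → ℕ)
    (rank : Λ → ℕ) (hinj : ∀ l, Function.Injective (line l))
    (hmem : ∀ x, ∃ k, line (owner x) k = x) (hK : ∀ l k, owner (line l k) = l ↔ K l ≤ k)
    (hrank : ∀ l k, k < K l → rank (owner (line l k)) < rank l) (s : Λ → EReal) :
    ∃ τ : X → ℕ, Function.Bijective τ ∧ ∀ l, SeriesHasSum (fun k => a (τ (line l k))) (s l) := by
  classical
  obtain ⟨c, hc⟩ := exists_partition_not_summable (Λ := Λ) (fun m => le_max_right (a m) 0)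
    (fun m => le_max_right (-a m) 0) ha.not_summable_posPart ha.not_summable_negPart
  have hR : ∀ l t, ∃ e : ℕ ≃ {m // c m = l}, SeriesHasSum (fun k => a (e k)) t := fun l t =>
    exists_equiv_seriesHasSum (a := fun m : {m // c m = l} => a m)
      ((Nat.cofinite_eq_atTop ▸ ha.tendsto_zero).comp Subtype.val_injective.tendsto_cofinite)
      (hc l).1 (hc l).2 t
  choose R hRs using hR
  choose pos hpos using hmem
  have hKpos : ∀ x, K (owner x) ≤ pos x := fun x => by rw [← hK, hpos]
  have hpos' : ∀ l k, owner (line l k) = l → pos (line l k) = k := fun l k h => by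
    have := hpos (line l k)
    rw [h] at this
    exact hinj l this
  -- The target for line `l` involves only values on lines of smaller rank, so `E` exists by
  -- well-founded recursion; by `hrank` the default `0` below is never used.
  obtain ⟨E, hE⟩ : ∃ E : ∀ l, ℕ ≃ {m // c m = l}, ∀ l, E l = R l (s l -
      ((∑ k ∈ Finset.range (K l), a (E (owner (line l k))
        (pos (line l k) - K (owner (line l k)))) : ℝ) : EReal)) := by
    have wf : WellFounded fun l l' : Λ => rank l < rank l' := (measure rank).wf
    refine ⟨wf.fix (C := fun l => ℕ ≃ {m // c m = l}) fun l ih => R l (s l -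
      ((∑ k ∈ Finset.range (K l), if h : rank (owner (line l k)) < rank l then
        a (ih (owner (line l k)) h (pos (line l k) - K (owner (line l k)))) else 0 : ℝ) : EReal)),
      fun l => ?_⟩
    rw [wf.fix_eq]
    congr 3
    refine Finset.sum_congr rfl fun k hk => ?_
    rw [dif_pos (hrank l k (Finset.mem_range.1 hk))]
  refine ⟨fun x => E (owner x) (pos x - K (owner x)), ⟨fun x y h => ?_, fun m => ?_⟩, fun l => ?_⟩
  · have hxy : owner x = owner y := by
      rw [← (E (owner x) (pos x - K (owner x))).2, ← (E (owner y) (pos y - K (owner y))).2]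
      exact congrArg c h
    have hx := hKpos x
    have hy := hKpos y
    have h2 : pos x - K (owner x) = pos y - K (owner y) := by
      simp only at h
      rw [hxy] at h
      have := (E (owner y)).injective (Subtype.val_injective h)
      rwa [hxy]
    have h3 : pos x = pos y := by rw [hxy] at hx h2; omega
    rw [← hpos x, ← hpos y, hxy, h3]
  · have h1 : ∀ j, owner (line (c m) (K (c m) + j)) = c m := fun j => (hK _ _).2 (by omega)
    refine ⟨line (c m) (K (c m) + (E (c m)).symm ⟨m, rfl⟩), ?_⟩
    simp only [hpos' _ _ (h1 _)]
    rw [h1]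
    simp
  · refine seriesHasSum_of_tail (K l) ?_
    have h := hRs l (s l - ((∑ k ∈ Finset.range (K l), a (E (owner (line l k))
        (pos (line l k) - K (owner (line l k)))) : ℝ) : EReal))
    rw [← hE l] at h
    refine h.congr fun m => ?_
    have h1 : owner (line l (K l + m)) = l := (hK _ _).2 (by omega)
    simp only [hpos' _ _ h1]
    rw [h1]
    simp

/-- The terms of a conditionally convergent series can be placed on `ℕⁿ⁺¹` with a prescribed sum
along every line parallel to a coordinate axis. -/
theorem exists_rearrangement_line_sums {n : ℕ} {a : ℕ → ℝ} (ha : ConditionallyConvergent a)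
    (s : Fin (n + 1) → (Fin n → ℕ) → EReal) :
    ∃ b : (Fin (n + 1) → ℕ) → ℝ, IsRearrangement a b ∧
      ∀ i y, SeriesHasSum (fun k => b (i.insertNth (α := fun _ => ℕ) k y)) (s i y) := by
  classical
  -- Weights order coordinates by size; the residue `j` modulo `n + 1` breaks ties, so the maximum
  -- is unique.
  set w : (Fin (n + 1) → ℕ) → Fin (n + 1) → ℕ := fun x j => (n + 1) * x j + j with hw
  have hwinj : ∀ x i j, w x i = w x j → i = j := by
    intro x i j h
    have h' := congrArg (· % (n + 1)) h
    simp only [hw, Nat.mul_add_mod, Nat.mod_eq_of_lt i.2, Nat.mod_eq_of_lt j.2] at h'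
    exact Fin.ext h'
  have hex : ∀ x, ∃ i, ∀ j, w x j ≤ w x i := fun x => Finite.exists_max (w x)
  choose dir hdir using hex
  have hdir_iff : ∀ x i, dir x = i ↔ ∀ j, w x j ≤ w x i := fun x i =>
    ⟨fun h => h ▸ hdir x, fun h => hwinj x _ _ (le_antisymm (h _) (hdir x _))⟩
  set line : Fin (n + 1) × (Fin n → ℕ) → ℕ → (Fin (n + 1) → ℕ) :=
    fun l k => l.1.insertNth (α := fun _ => ℕ) k l.2 with hline
  set owner : (Fin (n + 1) → ℕ) → Fin (n + 1) × (Fin n → ℕ) :=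
    fun x => (dir x, (dir x).removeNth x) with howner
  set rank : Fin (n + 1) × (Fin n → ℕ) → ℕ :=
    fun l => ∑ j : Fin n, ((n + 1) * l.2 j + l.1.succAbove j) with hrank
  have hw1 : ∀ l k, w (line l k) l.1 = (n + 1) * k + l.1 := fun l k => by simp [hw, hline]
  have hw2 : ∀ l k j, w (line l k) (l.1.succAbove j) = (n + 1) * l.2 j + l.1.succAbove j :=
    fun l k j => by simp [hw, hline]
  have hown : ∀ l k, owner (line l k) = l ↔ dir (line l k) = l.1 := by
    intro l k
    refine ⟨fun h => congrArg Prod.fst h, fun h => Prod.ext h ?_⟩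
    simp only [howner]
    rw [h]
    simp [hline]
  have hdl : ∀ l k, dir (line l k) = l.1 ↔
      ∀ j, (n + 1) * l.2 j + (l.1.succAbove j : ℕ) ≤ (n + 1) * k + l.1 := by
    intro l k
    rw [hdir_iff, hw1]
    refine ⟨fun h j => hw2 l k j ▸ h _, fun h j => ?_⟩
    rcases Fin.eq_self_or_eq_succAbove l.1 j with rfl | ⟨j, rfl⟩
    · rw [hw1]
    · rw [hw2]; exact h j
  have hexK : ∀ l, ∃ k, dir (line l k) = l.1 := by
    intro l
    refine ⟨∑ j, l.2 j + 1, (hdl _ _).2 fun j => ?_⟩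
    have h1 : l.2 j ≤ ∑ j, l.2 j := Finset.single_le_sum (fun _ _ => Nat.zero_le _)
      (Finset.mem_univ j)
    have h2 := Nat.mul_le_mul_left (n + 1) h1
    have h3 := (l.1.succAbove j).2
    rw [mul_add]
    omega
  have hsum : ∀ x, rank (owner x) + w x (dir x) = ∑ j, w x j := by
    intro x
    rw [Fin.sum_univ_succAbove _ (dir x), add_comm]
    rfl
  obtain ⟨τ, hτ, hs⟩ := exists_bijective_line_sums ha line owner (fun l => Nat.find (hexK l)) rank
    (fun l k k' h => by simpa [hline] using congrFun h l.1)
    (fun x => ⟨x (dir x), by simp [hline, howner]⟩)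
    (fun l k => by
      rw [hown]
      refine ⟨fun h => Nat.find_min' _ h, fun h => (hdl _ _).2 fun j => ?_⟩
      refine ((hdl _ _).1 (Nat.find_spec (hexK l)) j).trans ?_
      gcongr)
    -- The rank of a line is the total weight of its fixed coordinates. The owner leaves out the
    -- heaviest coordinate of the cell, `l` a strictly lighter one.
    (fun l k hk => by
      have h1 := Nat.find_min (hexK l) hk
      have h2 := hsum (line l k)
      rw [Fin.sum_univ_succAbove _ l.1] at h2
      simp only [hw2] at h2
      have h3 : w (line l k) l.1 < w (line l k) (dir (line l k)) :=
        lt_of_le_of_ne (hdir _ _) fun h => h1 (hwinj _ _ _ h).symm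
      change _ < ∑ j : Fin n, ((n + 1) * l.2 j + (l.1.succAbove j : ℕ))
      omega)
    (fun l => s l.1 l.2)
  exact ⟨fun x => a (τ x), ⟨τ, hτ, fun _ => rfl⟩, fun i y => hs (i, y)⟩

/-! ### Iterated sums in all orders -/

/-- An iterated sum can be evaluated by first summing over the innermost index. -/
lemma HasIteratedSum.of_snoc {n : ℕ} {f : (Fin (n + 1) → ℕ) → ℝ} {g : (Fin n → ℕ) → ℝ}
    {s : EReal}
    (hf : ∀ j : Fin n → ℕ, SeriesHasSum (fun k => f (Fin.snoc (α := fun _ => ℕ) j k)) (g j : EReal))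
    (hg : HasIteratedSum n g s) : HasIteratedSum (n + 1) f s := by
  induction n generalizing s with
  | zero =>
    refine ⟨fun k => f fun _ => k, fun k => ?_, ?_⟩
    · change ((f _ : ℝ) : EReal) = ((f _ : ℝ) : EReal)
      congr 2
      funext i
      rw [Fin.fin_one_eq_zero i]; rfl
    · have hs : s = (g Fin.elim0 : EReal) := hg
      rw [hs]
      refine (hf Fin.elim0).congr fun k => ?_
      congr 1
  | succ n ih =>
    obtain ⟨u, hu, hus⟩ := hg
    refine ⟨u, fun k => ih (fun j => ?_) (hu k), hus⟩
    refine (hf (Fin.cons k j)).congr fun m => ?_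
    rw [Fin.cons_snoc_eq_snoc_cons]

/-- The iterated sums of a rearrangement over `ℕⁿ⁺¹` of a conditionally convergent series, taken in
all the orders of the coordinates, can be prescribed arbitrarily. -/
theorem exists_rearrangement_hasIteratedSum (n : ℕ) (a : ℕ → ℝ) (ha : ConditionallyConvergent a)
    (s : Equiv.Perm (Fin (n + 1)) → EReal) :
    ∃ b : (Fin (n + 1) → ℕ) → ℝ, IsRearrangement a b ∧ ∀ σ : Equiv.Perm (Fin (n + 1)),
      HasIteratedSum (n + 1) (fun j : Fin (n + 1) → ℕ => b fun i => j (σ i)) (s σ) := by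
  induction n with
  | zero =>
    obtain ⟨b, hb, hbs⟩ := exists_rearrangement_line_sums ha fun _ _ => s 1
    refine ⟨b, hb, fun σ => ⟨fun k => b fun _ => k, fun k => ?_, ?_⟩⟩
    · change ((b _ : ℝ) : EReal) = ((b _ : ℝ) : EReal)
      congr 2
      funext i
      rw [Fin.fin_one_eq_zero (σ i)]; rfl
    · have : Subsingleton (Equiv.Perm (Fin (0 + 1))) :=
        inferInstanceAs (Subsingleton (Equiv.Perm (Fin 1)))
      rw [Subsingleton.elim σ 1]
      refine (hbs 0 Fin.elim0).congr fun k => ?_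
      congr 1
      funext i
      rw [Fin.fin_one_eq_zero i, Fin.insertNth_apply_same]
  | succ n ih =>
    have hL := fun i : Fin (n + 2) => ih fun π => s
      ((finSuccEquiv' i).trans (π.optionCongr.trans finSuccEquivLast.symm))
    choose L _ hLs using hL
    obtain ⟨b, hb, hbs⟩ := exists_rearrangement_line_sums ha fun i y => (L i y : EReal)
    refine ⟨b, hb, fun σ => ?_⟩
    set i := σ.symm (Fin.last (n + 1)) with hi
    -- With `i` the coordinate that `σ` makes innermost, `σ` is determined by the order `π` it
    -- induces on the remaining coordinates.
    obtain ⟨π, hπ⟩ : ∃ π : Equiv.Perm (Fin (n + 1)),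
        (finSuccEquiv' i).trans (π.optionCongr.trans finSuccEquivLast.symm) = σ := by
      set e := (finSuccEquiv' i).symm.trans (σ.trans finSuccEquivLast) with he
      have hen : e none = none := by simp [he, hi]
      refine ⟨Equiv.removeNone e, ?_⟩
      have hoc : (Equiv.removeNone e).optionCongr = e := by
        ext1 x
        rcases x with _ | x
        · simp [hen]
        · refine Equiv.removeNone_some e ?_
          refine Option.ne_none_iff_exists'.1 fun h => ?_
          exact Option.some_ne_none x (e.injective (h.trans hen.symm))
      rw [hoc]
      ext1 x
      simp [he]
    have hσi : σ i = Fin.last _ := by simp [hi]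
    have hσs : ∀ j, σ (i.succAbove j) = (π j).castSucc := fun j => by rw [← hπ]; simp
    have h1 := hLs i π
    simp only [hπ] at h1
    refine HasIteratedSum.of_snoc (fun j => ?_) h1
    refine (hbs i _).congr fun k => ?_
    congr 1
    funext x
    rcases Fin.eq_self_or_eq_succAbove i x with rfl | ⟨x, rfl⟩
    · rw [Fin.insertNth_apply_same, hσi, Fin.snoc_last]
    · rw [Fin.insertNth_apply_succAbove, hσs, Fin.snoc_castSucc]

theorem corollary2 (n : ℕ) (hn : 1 ≤ n) (a : ℕ → ℝ) (ha : ConditionallyConvergent a)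
    (s : Equiv.Perm (Fin n) → EReal) :
    ∃ b : (Fin n → ℕ) → ℝ, IsRearrangement a b ∧
      ∀ σ : Equiv.Perm (Fin n),
        HasIteratedSum n (fun j : Fin n → ℕ => b (fun i : Fin n => j (σ i))) (s σ) := by
  obtain ⟨m, rfl⟩ : ∃ m, n = m + 1 := Nat.exists_eq_succ_of_ne_zero (by omega)
  exact exists_rearrangement_hasIteratedSum m a ha s
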